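/- Let $\Omega$ be the open unit ball of $\mathbf R^3$, and let $\gamma\in C^2(\overline\Omega)$ satisfy $C^{-1}\le\gamma\le C$ in $\Omega$ for some $C>0$ and $\gamma=1$ in a neighbourhood of $\partial\Omega$. Put $q=\Delta\gamma^{1/2}/\gamma^{1/2}$ in $\Omega$, extended by $q=0$ to $\mathbf R^3$. Write $a\cdot b=\sum_j a_jb_j$ for the bilinear product on $\mathbf C^3$ and, for $\xi\in\mathbf R^3$, let $$V_\xi=\{\zeta\in\mathbf C^3\setminus\{0\}:\ \zeta\cdot\zeta=0,\ (\xi+\zeta)\cdot(\xi+\zeta)=0\}.$$ A complex geometrical optics (CGO) solution with frequency $\zeta$ is a function $\psi(\cdot,\zeta)$ on $\mathbf R^3$ with $(-\Delta+q)\psi=0$ in $\mathbf R^3$ in the sense of distributions and $(1+|x|^2)^{\delta/2}\,(\psi(x,\zeta) e^{-ix\cdot\zeta}-1)\in L^2(\mathbf R^3)$, where $-1<\delta<0$ is fixed. When there is exactly one CGO solution with frequency $\zeta$ (up to null sets), the scattering transform is $$\mathbf t(\xi,\zeta)=\int_\Omega e^{-ix\cdot(\xi+\zeta)}\psi(x,\zeta)q(x)\,dx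 .$$ Let $\Lambda_q f=\partial v/\partial\nu|_{\partial\Omega}$ be the Dirichlet-to-Neumann map, where $\nu$ is the outer unit normal and $v\in C^1(\overline\Omega)$ is the solution of $(-\Delta+q)v=0$ in $\Omega$ (in the sense of distributions), $v=f$ on $\partial\Omega$; let $\Lambda_0$ be this map for $q=0$; and let $$\mathbf t^{\exp}(\xi,\zeta)=\int_{\partial\Omega}e^{-ix\cdot(\xi+\zeta)}\,(\Lambda_q-\Lambda_0)e^{ix\cdot\zeta}\,d\sigma(x).$$ Suppose that $q$ is spherically symmetric, i.e. $q(x)=q(y)$ whenever $x,y\in\Omega$ and $|x|=|y|$. Then for all $\xi\in\mathbf R^3$ and $\zeta\in V_\xi$: 1. $\overline{\mathbf t(\xi,\zeta)}=\mathbf t(\xi,\zeta)$, for every $\delta\in(-1,0)$ for which there is exactly one CGO solution with frequency $\zeta$ (so that $\mathbf t(\xi,\zeta)$ is well defined); 2. $\overline{\mathbf t^{\exp}(\xi,\zeta)}=\mathbf t^{\exp}(\xi,\zeta)$. -/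

import Mathlib

open MeasureTheory Metric
open scoped ContDiff ComplexConjugate

noncomputable section

namespace ScatteringTransform

/-- Three-dimensional Euclidean space. -/
abbrev E3 : Type := EuclideanSpace ℝ (Fin 3)

/-- The domain: the open unit ball of `ℝ³`. -/
def Omega : Set E3 := ball 0 1

/-- A real vector regarded as a vector of `ℂ³`. -/
def toC (x : E3) : Fin 3 → ℂ := fun i => (x i : ℂ)

/-- The complex exponential `exp (i x · ζ)`, where the dot is the bilinear (not the Hermitian)
product of `ℂ³`. -/
def cexpI (ζ : Fin 3 → ℂ) (x : E3) : ℂ := Complex.exp (Complex.I * (toC x ⬝ᵥ ζ))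

/-- The set `V` of all nonzero `ζ ∈ ℂ³` with `ζ · ζ = 0`. -/
def V : Set (Fin 3 → ℂ) := {ζ | ζ ≠ 0 ∧ ζ ⬝ᵥ ζ = 0}

/-- The set `V_ξ` of all `ζ ∈ V` with `(ξ + ζ) · (ξ + ζ) = 0`. -/
def Vxi (ξ : E3) : Set (Fin 3 → ℂ) := {ζ | ζ ∈ V ∧ (toC ξ + ζ) ⬝ᵥ (toC ξ + ζ) = 0}

/-- The admissible conductivities on the closed unit ball: twice continuously differentiable up to
the boundary, bounded from above and below by positive constants, and equal to `1` near the
boundary. -/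
structure IsConductivity (γ : E3 → ℝ) : Prop where
  smooth : ContDiffOn ℝ 2 γ (closure Omega)
  bounds : ∃ C : ℝ, 0 < C ∧ ∀ x ∈ Omega, C⁻¹ ≤ γ x ∧ γ x ≤ C
  one_near_boundary : ∃ ρ : ℝ, ρ < 1 ∧ ∀ x ∈ closure Omega, ρ < ‖x‖ → γ x = 1

open scoped Classical in
/-- The potential `q = Δ √γ / √γ` in the unit ball, extended by zero to `ℝ³`. -/
def potential (γ : E3 → ℝ) (x : E3) : ℝ :=
  if x ∈ Omega then
    Laplacian.laplacian (fun y => Real.sqrt (γ y)) x / Real.sqrt (γ x)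
  else 0

/-- Spherical symmetry in the unit ball: the value at `x` depends on `‖x‖` only. -/
def SphericallySymmetric (q : E3 → ℝ) : Prop :=
  ∀ x ∈ Omega, ∀ y ∈ Omega, ‖x‖ = ‖y‖ → q x = q y

/-- `(-Δ + q) v = 0` in the open set `U` in the sense of distributions. -/
def SolvesSchrodinger (q : E3 → ℝ) (U : Set E3) (v : E3 → ℂ) : Prop :=
  ∀ φ : E3 → ℂ, ContDiff ℝ ∞ φ → HasCompactSupport φ → tsupport φ ⊆ U →
    ∫ x in U, v x * (-(Laplacian.laplacian φ x) + (q x : ℂ) * φ x) = 0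

/-! ### Complex geometrical optics solutions and the scattering transform -/

/-- `ψ` is a complex geometrical optics solution with frequency `ζ`: it solves
`(-Δ + q) ψ = 0` in `ℝ³`, and `μ = ψ exp (-i x · ζ)` satisfies `μ - 1 ∈ L²_δ`, that is,
`(1 + |x|²) ^ (δ / 2) (μ - 1) ∈ L²(ℝ³)`. -/
structure IsCGO (δ : ℝ) (q : E3 → ℝ) (ζ : Fin 3 → ℂ) (ψ : E3 → ℂ) : Prop where
  solves : SolvesSchrodinger q Set.univ ψ
  asymptotic : MemLp
    (fun x => (((1 + ‖x‖ ^ 2) ^ (δ / 2) : ℝ) : ℂ) * (ψ x * cexpI (-ζ) x - 1)) 2 volume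

/-- There is one and, up to null sets, only one complex geometrical optics solution with
frequency `ζ`. -/
def HasUniqueCGO (δ : ℝ) (q : E3 → ℝ) (ζ : Fin 3 → ℂ) : Prop :=
  ∃ ψ, IsCGO δ q ζ ψ ∧ ∀ ψ', IsCGO δ q ζ ψ' → ψ' =ᵐ[volume] ψ

open scoped Classical in
/-- The complex geometrical optics solution `ψ(·, ζ)` (zero if it is not uniquely determined). -/
def cgo (δ : ℝ) (q : E3 → ℝ) (ζ : Fin 3 → ℂ) : E3 → ℂ :=
  if h : HasUniqueCGO δ q ζ then h.choose else 0

/-- The scattering transform `t(ξ, ζ) = ∫_Ω exp (-i x · (ξ + ζ)) ψ(x, ζ) q(x) dx`. -/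
def scatteringTransform (δ : ℝ) (q : E3 → ℝ) (ξ : E3) (ζ : Fin 3 → ℂ) : ℂ :=
  ∫ x in Omega, cexpI (-(toC ξ + ζ)) x * cgo δ q ζ x * (q x : ℂ)

/-! ### The Dirichlet-to-Neumann map and `t^exp` -/

/-- `v ∈ C¹(closure Ω)` solves `(-Δ + q) v = 0` in `Ω` and `v = f` on the unit sphere. -/
structure IsDirichletSolution (q : E3 → ℝ) (f : sphere (0 : E3) 1 → ℂ) (v : E3 → ℂ) : Prop where
  smooth : ContDiffOn ℝ 1 v (closure Omega)
  solves : SolvesSchrodinger q Omega v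
  boundary : ∀ x : sphere (0 : E3) 1, v x = f x

/-- There is exactly one solution of the Dirichlet problem on the closed unit ball. -/
def HasUniqueDirichletSolution (q : E3 → ℝ) (f : sphere (0 : E3) 1 → ℂ) : Prop :=
  ∃ v, IsDirichletSolution q f v ∧
    ∀ w, IsDirichletSolution q f w → Set.EqOn w v (closure Omega)

open scoped Classical in
/-- The Dirichlet-to-Neumann map `Λ_q f = ∂v/∂ν`, where `(-Δ + q) v = 0` in `Ω`, `v = f` on the
unit sphere, and `ν(x) = x` is the outer unit normal (zero if the Dirichlet problem is not uniquely
solvable in `C¹(closure Ω)`). -/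
def dirichletToNeumann (q : E3 → ℝ) (f : sphere (0 : E3) 1 → ℂ) : sphere (0 : E3) 1 → ℂ :=
  if h : HasUniqueDirichletSolution q f then
    fun x => fderivWithin ℝ h.choose (closure Omega) x x
  else 0

/-- `t^exp(ξ, ζ) = ∫_{∂Ω} exp (-i x · (ξ + ζ)) (Λ_q - Λ_0) exp (i x · ζ) dσ(x)`, where `σ` is the
surface measure of the unit sphere. -/
def scatteringTransformExp (q : E3 → ℝ) (ξ : E3) (ζ : Fin 3 → ℂ) : ℂ :=
  ∫ x : sphere (0 : E3) 1,
    cexpI (-(toC ξ + ζ)) x *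
      (dirichletToNeumann q (fun y => cexpI ζ y) x -
        dirichletToNeumann 0 (fun y => cexpI ζ y) x) ∂(volume : Measure E3).toSphere

end ScatteringTransform

end

namespace ScatteringTransform

/-! Let `R` be the half turn about `Im ζ`. As `ζ · ζ = 0`, the vectors `Re ζ` and `Im ζ` are
orthogonal, so `R` fixes `Im ζ` and negates `Re ζ`; hence `v ↦ conj (v ∘ R)` fixes `exp (i x · ζ)`.
The vector `ξ + ζ` has the same imaginary part and also squares to zero, so the same `R` serves for
`exp (-i x · (ξ + ζ))`. As `q` is real and radial, this operation maps solutions to solutions, and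
uniqueness makes it fix the CGO solution and the Dirichlet solution with data `exp (i x · ζ)`.
Substituting `R x` for `x` in the two integrals then shows that they equal their conjugates. -/

/-- The function `x ↦ conj (v (R x))`. -/
noncomputable def conjComp (R : E3 ≃ₗᵢ[ℝ] E3) (v : E3 → ℂ) (x : E3) : ℂ := conj (v (R x))

/-- The trace of the second derivative may be taken in any orthonormal basis; at `R x` the image
under `R` of the standard one is used. -/
theorem laplacian_comp_linearIsometryEquiv {φ : E3 → ℂ} (hφ : ContDiff ℝ 2 φ)
    (R : E3 ≃ₗᵢ[ℝ] E3) (x : E3) :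
    Laplacian.laplacian (φ ∘ R) x = Laplacian.laplacian φ (R x) := by
  rw [InnerProductSpace.laplacian_eq_iteratedFDeriv_orthonormalBasis φ
      ((stdOrthonormalBasis ℝ E3).map R),
    InnerProductSpace.laplacian_eq_iteratedFDeriv_stdOrthonormalBasis]
  refine Finset.sum_congr rfl fun i _ => ?_
  have h := (R.toContinuousLinearEquiv : E3 →L[ℝ] E3).iteratedFDeriv_comp_right hφ x
    (i := 2) le_rfl
  change iteratedFDeriv ℝ 2 (φ ∘ (R.toContinuousLinearEquiv : E3 →L[ℝ] E3)) x _ = _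
  rw [h, ContinuousMultilinearMap.compContinuousLinearMap_apply]
  congr 1
  ext j
  fin_cases j <;> rfl

theorem contDiff_conjComp {n : WithTop ℕ∞} {φ : E3 → ℂ} (hφ : ContDiff ℝ n φ)
    (R : E3 ≃ₗᵢ[ℝ] E3) : ContDiff ℝ n (conjComp R φ) :=
  Complex.conjCLE.contDiff.comp (hφ.comp R.contDiff)

theorem laplacian_conjComp {φ : E3 → ℂ} (hφ : ContDiff ℝ 2 φ) (R : E3 ≃ₗᵢ[ℝ] E3) (x : E3) :
    Laplacian.laplacian (conjComp R φ) x = conj (Laplacian.laplacian φ (R x)) := by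
  rw [← laplacian_comp_linearIsometryEquiv hφ]
  exact congrFun (InnerProductSpace.laplacian_CLE_comp_left (l := Complex.conjCLE)
    (f := φ ∘ R)) x

theorem tsupport_conjComp (R : E3 ≃ₗᵢ[ℝ] E3) (φ : E3 → ℂ) :
    tsupport (conjComp R φ) = R ⁻¹' tsupport φ := by
  have h : Function.support (conjComp R φ) = R ⁻¹' Function.support φ := by
    ext x
    simp [conjComp]
  rw [tsupport, tsupport, h]
  exact (R.toHomeomorph.preimage_closure _).symm

theorem setIntegral_conjComp (R : E3 ≃ₗᵢ[ℝ] E3) (U : Set E3) (F : E3 → ℂ) :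
    ∫ x in R ⁻¹' U, conjComp R F x = conj (∫ x in U, F x) := by
  rw [← integral_conj]
  exact R.measurePreserving.setIntegral_preimage_emb
    R.toHomeomorph.measurableEmbedding (fun x => conj (F x)) U

theorem conjComp_symm_conjComp (R : E3 ≃ₗᵢ[ℝ] E3) (v : E3 → ℂ) :
    conjComp R (conjComp R.symm v) = v := by
  ext x
  simp [conjComp]

/-- The operation is moved onto the test function, using `R.symm`, and undone by a change of
variables. -/
theorem SolvesSchrodinger.conjComp {q : E3 → ℝ} {U : Set E3} {v : E3 → ℂ}
    (hv : SolvesSchrodinger q U v) {R : E3 ≃ₗᵢ[ℝ] E3} (hU : R ⁻¹' U = U)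
    (hq : ∀ x, q (R x) = q x) : SolvesSchrodinger q U (conjComp R v) := by
  intro φ hφ hc hs
  have hφ' := contDiff_conjComp hφ R.symm
  have hts : tsupport (ScatteringTransform.conjComp R.symm φ) = R '' tsupport φ := by
    rw [tsupport_conjComp]
    exact (R.toEquiv.image_eq_preimage_symm _).symm
  have h := hv (ScatteringTransform.conjComp R.symm φ) hφ'
    (by rw [HasCompactSupport, hts]; exact hc.isCompact.image R.continuous)
    (by rw [hts, Set.image_subset_iff, hU]; exact hs)
  have h2 := setIntegral_conjComp R U fun x =>
    v x * (-(Laplacian.laplacian (ScatteringTransform.conjComp R.symm φ) x)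
      + (q x : ℂ) * ScatteringTransform.conjComp R.symm φ x)
  rw [h, hU, map_zero] at h2
  rw [← h2]
  congr 1
  ext x
  have hl := laplacian_conjComp (hφ'.of_le (by norm_cast)) R x
  rw [conjComp_symm_conjComp] at hl
  simp [ScatteringTransform.conjComp, hl, hq]

/-! ### The half turn and the exponentials -/

/-- The half turn of `ℝ³` about the imaginary part of `ζ`. -/
noncomputable def halfTurn (ζ : Fin 3 → ℂ) : E3 ≃ₗᵢ[ℝ] E3 :=
  (ℝ ∙ (WithLp.toLp 2 fun i => (ζ i).im : E3)).reflection

theorem toC_dotProduct (x : E3) (ζ : Fin 3 → ℂ) :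
    toC x ⬝ᵥ ζ = ((inner ℝ x (WithLp.toLp 2 fun i => (ζ i).re : E3) : ℝ) : ℂ)
      + ((inner ℝ x (WithLp.toLp 2 fun i => (ζ i).im : E3) : ℝ) : ℂ) * Complex.I := by
  apply Complex.ext <;>
    simp [toC, dotProduct, PiLp.inner_apply, Fin.sum_univ_three, mul_comm]

/-- Since `Im (η · η) = 2 Re η · Im η`, the hypothesis `hη` says that `Re η` is orthogonal to the
axis. Allowing `η ≠ ζ` with equal imaginary parts covers `η = ξ + ζ`. -/
theorem toC_halfTurn_dotProduct {η ζ : Fin 3 → ℂ} (hi : ∀ i, (η i).im = (ζ i).im)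
    (hη : (η ⬝ᵥ η).im = 0) (x : E3) :
    toC (halfTurn ζ x) ⬝ᵥ η = -conj (toC x ⬝ᵥ η) := by
  have hR (y : E3) : inner ℝ (halfTurn ζ x) y = inner ℝ x (halfTurn ζ y) := by
    rw [← (halfTurn ζ).inner_map_map x, halfTurn, Submodule.reflection_reflection]
  have him : halfTurn ζ (WithLp.toLp 2 fun i => (η i).im) = WithLp.toLp 2 fun i => (η i).im := by
    simp only [hi]
    exact Submodule.reflection_mem_subspace_eq_self (Submodule.mem_span_singleton_self _)
  have hre : halfTurn ζ (WithLp.toLp 2 fun i => (η i).re)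
      = -WithLp.toLp 2 fun i => (η i).re := by
    refine Submodule.reflection_mem_subspace_orthogonalComplement_eq_neg
      (Submodule.mem_orthogonal_singleton_iff_inner_right.2 ?_)
    simp only [← hi]
    simp only [dotProduct, Fin.sum_univ_three, Complex.add_im, Complex.mul_im] at hη
    simp only [PiLp.inner_apply, Fin.sum_univ_three, RCLike.inner_apply, conj_trivial]
    linarith
  rw [toC_dotProduct, toC_dotProduct, hR, hR, him, hre]
  simp [add_comm]

theorem conj_cexpI_halfTurn {η ζ : Fin 3 → ℂ} (hi : ∀ i, (η i).im = (ζ i).im)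
    (hη : (η ⬝ᵥ η).im = 0) (x : E3) : conj (cexpI η (halfTurn ζ x)) = cexpI η x := by
  rw [cexpI, cexpI, toC_halfTurn_dotProduct hi hη, ← Complex.exp_conj]
  simp

theorem conj_cexpI_neg_halfTurn {η ζ : Fin 3 → ℂ} (hi : ∀ i, (η i).im = (ζ i).im)
    (hη : (η ⬝ᵥ η).im = 0) (x : E3) : conj (cexpI (-η) (halfTurn ζ x)) = cexpI (-η) x := by
  rw [cexpI, cexpI, dotProduct_neg, dotProduct_neg, toC_halfTurn_dotProduct hi hη,
    ← Complex.exp_conj]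
  simp

theorem preimage_Omega (R : E3 ≃ₗᵢ[ℝ] E3) : R ⁻¹' Omega = Omega := by
  ext x
  simp [Omega]

theorem preimage_closure_Omega (R : E3 ≃ₗᵢ[ℝ] E3) : R ⁻¹' closure Omega = closure Omega := by
  rw [← R.coe_toHomeomorph, R.toHomeomorph.preimage_closure, R.coe_toHomeomorph, preimage_Omega]

theorem potential_comp_linearIsometryEquiv {γ : E3 → ℝ}
    (hq : SphericallySymmetric (potential γ)) (R : E3 ≃ₗᵢ[ℝ] E3) (x : E3) :
    potential γ (R x) = potential γ x := by
  have hiff : R x ∈ Omega ↔ x ∈ Omega := by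
    rw [← Set.mem_preimage, preimage_Omega]
  by_cases hx : x ∈ Omega
  · exact hq _ (hiff.2 hx) _ hx (R.norm_map x)
  · rw [potential, potential, if_neg hx, if_neg (mt hiff.1 hx)]

theorem IsCGO.conjComp {δ : ℝ} {q : E3 → ℝ} {ζ : Fin 3 → ℂ} {ψ : E3 → ℂ} (hψ : IsCGO δ q ζ ψ)
    (hζ : (ζ ⬝ᵥ ζ).im = 0) (hq : ∀ x, q (halfTurn ζ x) = q x) :
    IsCGO δ q ζ (conjComp (halfTurn ζ) ψ) where
  solves := hψ.solves.conjComp Set.preimage_univ hq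
  asymptotic := by
    have h := (hψ.asymptotic.comp_measurePreserving (halfTurn ζ).measurePreserving).star
    rw [show (fun x : E3 => (((1 + ‖x‖ ^ 2) ^ (δ / 2) : ℝ) : ℂ) *
      (ScatteringTransform.conjComp (halfTurn ζ) ψ x * cexpI (-ζ) x - 1)) = _ from ?_]
    · exact h
    ext x
    simp only [Pi.star_apply, Function.comp_apply, RCLike.star_def, map_mul, map_sub, map_one,
      Complex.conj_ofReal, LinearIsometryEquiv.norm_map,
      conj_cexpI_neg_halfTurn (fun _ => rfl) hζ, ScatteringTransform.conjComp]

theorem conj_scatteringTransform {δ : ℝ} {q : E3 → ℝ} {ξ : E3} {ζ : Fin 3 → ℂ}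
    (hζ : (ζ ⬝ᵥ ζ).im = 0) (hξζ : ((toC ξ + ζ) ⬝ᵥ (toC ξ + ζ)).im = 0)
    (hq : ∀ x, q (halfTurn ζ x) = q x) (hu : HasUniqueCGO δ q ζ) :
    conj (scatteringTransform δ q ξ ζ) = scatteringTransform δ q ξ ζ := by
  have hcgo : IsCGO δ q ζ (cgo δ q ζ) ∧ ∀ ψ', IsCGO δ q ζ ψ' → ψ' =ᵐ[volume] cgo δ q ζ := by
    rw [cgo, dif_pos hu]
    exact hu.choose_spec
  have hae := hcgo.2 _ (hcgo.1.conjComp hζ hq)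
  rw [scatteringTransform, ← setIntegral_conjComp (halfTurn ζ), preimage_Omega]
  refine integral_congr_ae (ae_restrict_of_ae ?_)
  filter_upwards [hae] with x hx
  rw [conjComp] at hx
  simp only [conjComp, map_mul, hx, Complex.conj_ofReal, hq]
  rw [conj_cexpI_neg_halfTurn (by simp [toC]) hξζ]

/-! ### The unit sphere and the Dirichlet-to-Neumann map -/

/-- The restriction of a linear isometry of `ℝ³` to the unit sphere. -/
noncomputable def sphereEquiv (R : E3 ≃ₗᵢ[ℝ] E3) : sphere (0 : E3) 1 ≃ₜ sphere (0 : E3) 1 :=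
  R.toHomeomorph.subtype fun x => by simp

-- The surface measure of `s` is a multiple of the volume of the cone `(0, 1) • s`, and `R` commutes
-- with scaling and preserves volume.
open scoped Pointwise in
theorem measurePreserving_sphereEquiv (R : E3 ≃ₗᵢ[ℝ] E3) :
    MeasurePreserving (sphereEquiv R) (volume : Measure E3).toSphere
      (volume : Measure E3).toSphere := by
  refine ⟨(sphereEquiv R).continuous.measurable, Measure.ext fun s hs => ?_⟩
  have hs' := (sphereEquiv R).continuous.measurable hs
  rw [Measure.map_apply (sphereEquiv R).continuous.measurable hs, Measure.toSphere_apply' _ hs,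
    Measure.toSphere_apply' _ hs']
  congr 1
  have hval : ((↑) : sphere (0 : E3) 1 → E3) '' (sphereEquiv R ⁻¹' s)
      = R ⁻¹' (((↑) : sphere (0 : E3) 1 → E3) '' s) := by
    ext x
    constructor
    · rintro ⟨y, hy, rfl⟩
      exact ⟨_, hy, rfl⟩
    · rintro ⟨y, hy, hyx⟩
      refine ⟨⟨x, ?_⟩, ?_, rfl⟩
      · have := y.2
        rw [hyx] at this
        simpa using this
      · have : sphereEquiv R ⟨x, by have := y.2; rw [hyx] at this; simpa using this⟩ = y :=
          Subtype.ext hyx.symm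
        rw [Set.mem_preimage, this]
        exact hy
  have hpre : Set.Ioo (0 : ℝ) 1 • (R ⁻¹' (((↑) : sphere (0 : E3) 1 → E3) '' s))
      = R ⁻¹' (Set.Ioo (0 : ℝ) 1 • (((↑) : sphere (0 : E3) 1 → E3) '' s)) := by
    ext x
    simp only [Set.mem_smul, Set.mem_preimage]
    constructor
    · rintro ⟨r, hr, y, hy, rfl⟩
      exact ⟨r, hr, R y, hy, (map_smul R r y).symm⟩
    · rintro ⟨r, hr, y, hy, hyx⟩
      refine ⟨r, hr, R.symm y, by simpa using hy, R.injective ?_⟩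
      rw [map_smul, R.apply_symm_apply, hyx]
  rw [hval, hpre]
  exact R.measurePreserving.measure_preimage_emb R.toHomeomorph.measurableEmbedding _

theorem uniqueDiffOn_closure_Omega : UniqueDiffOn ℝ (closure Omega) :=
  uniqueDiffOn_convex (convex_ball (0 : E3) 1).closure
    ((nonempty_ball.2 one_pos).mono (interior_maximal subset_closure isOpen_ball))

theorem fderivWithin_conjComp {R : E3 ≃ₗᵢ[ℝ] E3} (v : E3 → ℂ) {x : E3} (hx : x ∈ closure Omega)
    (y : E3) : fderivWithin ℝ (conjComp R v) (closure Omega) x y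
      = conj (fderivWithin ℝ v (closure Omega) (R x) (R y)) := by
  have hu := uniqueDiffOn_closure_Omega x hx
  have h1 := Complex.conjCLE.comp_fderivWithin (f := v ∘ R) hu
  have h2 := R.toContinuousLinearEquiv.comp_right_fderivWithin (f := v) (s := closure Omega)
    (x := x) (by
      have := preimage_closure_Omega R
      change UniqueDiffWithinAt ℝ (R ⁻¹' closure Omega) x
      rwa [this])
  change fderivWithin ℝ (v ∘ R) (R ⁻¹' closure Omega) x = _ at h2
  rw [preimage_closure_Omega] at h2
  change fderivWithin ℝ (Complex.conjCLE ∘ (v ∘ R)) (closure Omega) x y = _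
  rw [h1, h2]
  rfl

theorem IsDirichletSolution.conjComp {q : E3 → ℝ} {f : sphere (0 : E3) 1 → ℂ} {v : E3 → ℂ}
    (hv : IsDirichletSolution q f v) {R : E3 ≃ₗᵢ[ℝ] E3} (hq : ∀ x, q (R x) = q x)
    (hf : ∀ x, conj (f (sphereEquiv R x)) = f x) :
    IsDirichletSolution q f (conjComp R v) where
  smooth := Complex.conjCLE.contDiff.comp_contDiffOn
    (hv.smooth.comp R.contDiff.contDiffOn (preimage_closure_Omega R).ge)
  solves := hv.solves.conjComp (preimage_Omega R) hq
  boundary x := by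
    rw [← hf x, ← hv.boundary]
    rfl

theorem conj_dirichletToNeumann {q : E3 → ℝ} {f : sphere (0 : E3) 1 → ℂ} {R : E3 ≃ₗᵢ[ℝ] E3}
    (hq : ∀ x, q (R x) = q x) (hf : ∀ x, conj (f (sphereEquiv R x)) = f x)
    (x : sphere (0 : E3) 1) :
    conj (dirichletToNeumann q f (sphereEquiv R x)) = dirichletToNeumann q f x := by
  by_cases hu : HasUniqueDirichletSolution q f
  · have hx : (x : E3) ∈ closure Omega := by
      rw [Omega, closure_ball _ one_ne_zero]
      exact sphere_subset_closedBall x.2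
    obtain ⟨hv, hw⟩ := hu.choose_spec
    have heq := hw _ (hv.conjComp hq hf)
    simp only [dirichletToNeumann, dif_pos hu]
    -- The normal at `x` is `x` itself, so `R` carries it to the normal at `R x`.
    rw [← fderivWithin_congr heq (heq hx), fderivWithin_conjComp _ hx]
    rfl
  -- Without unique solvability both sides are the default value zero.
  · simp [dirichletToNeumann, dif_neg hu]

theorem conj_scatteringTransformExp {q : E3 → ℝ} {ξ : E3} {ζ : Fin 3 → ℂ}
    (hζ : (ζ ⬝ᵥ ζ).im = 0) (hξζ : ((toC ξ + ζ) ⬝ᵥ (toC ξ + ζ)).im = 0)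
    (hq : ∀ x, q (halfTurn ζ x) = q x) :
    conj (scatteringTransformExp q ξ ζ) = scatteringTransformExp q ξ ζ := by
  have hf (x : sphere (0 : E3) 1) :
      conj (cexpI ζ (sphereEquiv (halfTurn ζ) x)) = cexpI ζ x :=
    conj_cexpI_halfTurn (fun _ => rfl) hζ x
  have he (x : sphere (0 : E3) 1) :
      conj (cexpI (-(toC ξ + ζ)) (sphereEquiv (halfTurn ζ) x)) = cexpI (-(toC ξ + ζ)) x :=
    conj_cexpI_neg_halfTurn (by simp [toC]) hξζ x
  rw [scatteringTransformExp, ← integral_conj,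
    ← (measurePreserving_sphereEquiv (halfTurn ζ)).integral_comp
      (sphereEquiv (halfTurn ζ)).measurableEmbedding]
  refine integral_congr_ae (Filter.Eventually.of_forall fun x => ?_)
  simp only [map_mul, map_sub]
  rw [he, conj_dirichletToNeumann (f := fun y => cexpI ζ y) hq hf,
    conj_dirichletToNeumann (q := 0) (f := fun y => cexpI ζ y) (fun _ => rfl) hf]

end ScatteringTransform

theorem mainTheorem4 (γ : EuclideanSpace ℝ (Fin 3) → ℝ)
    (hγ : ScatteringTransform.IsConductivity γ)
    (hq : ScatteringTransform.SphericallySymmetric (ScatteringTransform.potential γ))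
    (ξ : EuclideanSpace ℝ (Fin 3)) (ζ : Fin 3 → ℂ) (hζ : ζ ∈ ScatteringTransform.Vxi ξ) :
    (∀ δ : ℝ, -1 < δ → δ < 0 →
      ScatteringTransform.HasUniqueCGO δ (ScatteringTransform.potential γ) ζ →
        conj (ScatteringTransform.scatteringTransform δ (ScatteringTransform.potential γ) ξ ζ) =
          ScatteringTransform.scatteringTransform δ (ScatteringTransform.potential γ) ξ ζ) ∧
    conj (ScatteringTransform.scatteringTransformExp (ScatteringTransform.potential γ) ξ ζ) =
      ScatteringTransform.scatteringTransformExp (ScatteringTransform.potential γ) ξ ζ := by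
  have h1 : (ζ ⬝ᵥ ζ).im = 0 := by rw [hζ.1.2, Complex.zero_im]
  have h2 : ((ScatteringTransform.toC ξ + ζ) ⬝ᵥ (ScatteringTransform.toC ξ + ζ)).im = 0 := by
    rw [hζ.2, Complex.zero_im]
  have h3 := ScatteringTransform.potential_comp_linearIsometryEquiv hq
    (ScatteringTransform.halfTurn ζ)
  exact ⟨fun _ _ _ hu => ScatteringTransform.conj_scatteringTransform h1 h2 h3 hu,
    ScatteringTransform.conj_scatteringTransformExp h1 h2 h3⟩
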